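/- Let $P$ and $Q$ be finite posets and let $\mathbb{K}$ be a field. For an order-preserving map $\phi\colon P\to Q$ put $u_\phi=\prod_{p\in P}x_{p,\phi(p)}$, and let $L(P,Q)$ be the ideal generated by all monomials $u_\phi$, $\phi\colon P\to Q$ order-preserving, in the polynomial ring $S_{P,Q}=\mathbb{K}[x_{p,q} : p\in P,\ q\in Q]$. A poset is called rooted if no element is strictly larger than each of two incomparable elements, and co-rooted if no element is strictly smaller than each of two incomparable elements. It is called connected if its Hasse diagram is a connected (in particular non-empty) graph, and a disjoint union of chains if it can be partitioned into chains such that elements of different parts are incomparable. An ideal $I$ of a polynomial ring $S$ is unmixed if all associated primes of $I$ (that is, of the $S$-module $S/I$) have the same height. For a squarefree monomial ideal $I$ in the variables $x_v$, $v\in V$, with $V$ finite, put $x_F=\prod_{v\in F}x_v$ for $F\subseteq V$, let $\Delta=\{F\subseteq V : x_F\notin I\}$ be its Stanley–Reisner complex and $\Delta^\vee=\{F\subseteq V : V\setminus F\notin\Delta\}$ the Alexander dual complex; the Alexander dual $I^\vee$ of $I$ is the Stanley–Reisner ideal of $\Delta^\vee$, i.e. the ideal generated by all $x_F$ with $F\notin\Delta^\vee$.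 Finally, $L(Q,P)^\tau\subseteq S_{P,Q}$ denotes the image of $L(Q,P)\subseteq S_{Q,P}$ under the isomorphism $S_{Q,P}\to S_{P,Q}$, $x_{q,p}\mapsto x_{p,q}$. Then $L(P,Q)$ is unmixed if and only if one of the following conditions holds: (a) $P$ and $Q$ are both rooted; (b) $P$ and $Q$ are both co-rooted; (c) $P$ or $Q$ is a disjoint union of chains. Moreover, if $P$ or $Q$ is connected and $L(P,Q)$ is unmixed, then $L(P,Q)^\vee=L(Q,P)^\tau$. -/

import Mathlib

namespace PosetHomIdeal

section Posets

/-- A poset is rooted if no element lies strictly above two incomparable elements. -/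
def IsRooted (P : Type*) [PartialOrder P] : Prop :=
  ∀ p₁ p₂ : P, IncompRel (· ≤ ·) p₁ p₂ → ¬ ∃ p : P, p₁ < p ∧ p₂ < p

/-- A poset is co-rooted if no element lies strictly below two incomparable elements. -/
def IsCorooted (P : Type*) [PartialOrder P] : Prop :=
  ∀ p₁ p₂ : P, IncompRel (· ≤ ·) p₁ p₂ → ¬ ∃ p : P, p < p₁ ∧ p < p₂

/-- A poset is connected if its Hasse diagram is connected as a graph
(in particular it is non-empty). -/
def IsConnected (P : Type*) [PartialOrder P] : Prop :=
  (SimpleGraph.hasse P).Connected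

/-- A poset is a disjoint union of chains if it can be partitioned into chains such that
elements of different blocks are never comparable. -/
def IsDisjointUnionOfChains (P : Type*) [PartialOrder P] : Prop :=
  ∃ C : Set (Set P), Setoid.IsPartition C ∧ (∀ A ∈ C, IsChain (· ≤ ·) A) ∧
    C.Pairwise fun A B => ∀ a ∈ A, ∀ b ∈ B, ¬ a ≤ b

end Posets

section Ideals

/-- An ideal `I` of `S` is unmixed if all associated primes of `I`, that is, of the module
`S ⧸ I`, have the same height. -/
def IsUnmixed {S : Type*} [CommRing S] (I : Ideal S) : Prop :=
  ∀ 𝔭 ∈ associatedPrimes S (S ⧸ I), ∀ 𝔮 ∈ associatedPrimes S (S ⧸ I), 𝔭.height = 𝔮.height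

variable (K : Type*) [Field K]

/-- The squarefree monomial `x_F`, the product of the variables `x_i` with `i ∈ F`. -/
noncomputable def squarefreeMonomial {V : Type*} (F : Finset V) : MvPolynomial V K :=
  ∏ i ∈ F, MvPolynomial.X i

variable {K}

/-- The Stanley-Reisner complex of an ideal `I`: its faces are the sets `F` with `x_F ∉ I`.
Simplicial complexes on `V` are lower sets of finite subsets of `V`; the complex without any face
and the complex whose only face is `∅` are both allowed, and they are different. -/
def stanleyReisnerComplex {V : Type*} (I : Ideal (MvPolynomial V K)) : LowerSet (Finset V) where
  carrier := {F | squarefreeMonomial K F ∉ I}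
  lower' := fun _ _ hGF hF hG =>
    hF (I.mem_of_dvd (Finset.prod_dvd_prod_of_subset _ _ _ hGF) hG)

variable (K)

/-- The Stanley-Reisner ideal of a simplicial complex, generated by the `x_F` for the
non-faces `F`. -/
noncomputable def stanleyReisnerIdeal {V : Type*} (Δ : LowerSet (Finset V)) :
    Ideal (MvPolynomial V K) :=
  Ideal.span (squarefreeMonomial K '' {F | F ∉ Δ})

/-- The Alexander dual of a simplicial complex: its faces are the complements of the
non-faces. -/
def dualComplex {V : Type*} [Fintype V] [DecidableEq V] (Δ : LowerSet (Finset V)) :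
    LowerSet (Finset V) where
  carrier := {F | Fᶜ ∉ Δ}
  lower' := fun _ _ hGF hF hG => hF (Δ.lower (Finset.compl_subset_compl.2 hGF) hG)

variable {K}

/-- The Alexander dual `I^∨` of a squarefree monomial ideal `I`: the Stanley-Reisner ideal of the
Alexander dual of the Stanley-Reisner complex of `I`. -/
noncomputable def alexanderDual {V : Type*} [Fintype V] [DecidableEq V]
    (I : Ideal (MvPolynomial V K)) : Ideal (MvPolynomial V K) :=
  stanleyReisnerIdeal K (dualComplex (stanleyReisnerComplex I))

variable (K)

/-- The ideal `L(P,Q)` of `K[x_{p,q} : p ∈ P, q ∈ Q]`, generated by the monomials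
`u_φ = ∏ p, x_{p,φ(p)}` for all order-preserving maps `φ : P → Q`. -/
noncomputable def L (P Q : Type*) [PartialOrder P] [Fintype P] [PartialOrder Q] :
    Ideal (MvPolynomial (P × Q) K) :=
  Ideal.span (Set.range fun φ : P →o Q => ∏ p : P, MvPolynomial.X (p, φ p))

variable {K}

/-- `I^τ` is obtained from `I` by switching the indices of the variables, `x_{q,p} ↦ x_{p,q}`. -/
noncomputable def switchIndices {Q P : Type*} (I : Ideal (MvPolynomial (Q × P) K)) :
    Ideal (MvPolynomial (P × Q) K) :=
  I.map (MvPolynomial.rename (R := K) (Prod.swap : Q × P → P × Q))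

end Ideals

end PosetHomIdeal

/-!
The associated primes of a squarefree monomial ideal are generated by the minimal transversals of
the supports of its generators, and its Alexander dual is generated by the monomials of the
transversals. For `L(P, Q)` these transversals are the covers: the sets of pairs which meet the
graph of every monotone map `P → Q`. Both claims therefore concern covers only.

Suppose first that `P` is rooted or `Q` co-rooted, and that `P` is co-rooted or `Q` rooted. For any
relation `F` between `P` and `Q`, either `F` contains the graph of a monotone map `φ : P → Q`, or
its complement contains the transposed graph of a monotone map `ψ : Q → P` with values in a single
component of `P`. Conversely every such transposed graph is a cover: the monotone map `ψ ∘ φ` (or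
`φ ∘ ψ`) maps a component with a least or a greatest element to itself, so it has a fixed point.
Hence the minimal covers are exactly these transposed graphs, and they all have `|Q|` elements. If
`P` or `Q` is connected, every monotone `ψ` has its values in a single component, so that the
Alexander dual is generated by the monomials of all transposed graphs.

Otherwise, up to duality, `P` contains `p₁, p₂ < p` and `Q` contains `q < q₁, q₂`, where `p₁`, `p₂`
are incomparable and so are `q₁`, `q₂`. A cover meets the graph of every constant map, so it has at
least `|Q|` elements, and `|Q|` is attained by `{p} × Q`. A minimal cover inside
`{p₁} × {y | ¬ q₁ ≤ y} ∪ {p₂} × {y | ¬ q₂ ≤ y} ∪ {p} × {y | q₁ ≤ y ∧ q₂ ≤ y}` has more elements,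
because it must contain both `(p₁, q)` and `(p₂, q)`.
-/

namespace PosetHomIdeal

section AssociatedPrimes

theorem associatedPrimes_quotient {R : Type*} [CommRing R] (I : Ideal R) :
    associatedPrimes R (R ⧸ I) = Submodule.associatedPrimes I := by
  have hcolon (f : R) :
      (⊥ : Submodule R (R ⧸ I)).colon {Ideal.Quotient.mk I f} = Submodule.colon I {f} := by
    ext g
    rw [Submodule.mem_colon_singleton, Submodule.mem_colon_singleton, Submodule.mem_bot,
      Algebra.smul_def, Ideal.Quotient.algebraMap_eq, ← map_mul, Ideal.Quotient.eq_zero_iff_mem,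
      smul_eq_mul]
  ext 𝔭
  rw [AssociatedPrimes.mem_iff, Submodule.AssociatePrimes.mem_iff, IsAssociatedPrime,
    Submodule.isAssociatedPrime_def, Submodule.isAssociatedPrime_def]
  simp only [Ideal.Quotient.mk_surjective.exists, hcolon]

theorem associatedPrimes_quotient_sInf {R : Type*} [CommRing R] {s : Set (Ideal R)}
    (hs : s.Finite) (hanti : IsAntichain (· ≤ ·) s) (hprime : ∀ 𝔭 ∈ s, 𝔭.IsPrime) :
    associatedPrimes R (R ⧸ sInf s) = s := by
  lift s to Finset (Ideal R) using hs
  have hrad {𝔭 : Ideal R} (h𝔭 : 𝔭 ∈ s) :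
      (Submodule.colon 𝔭 (Set.univ : Set R)).radical = 𝔭 := by
    simp [Submodule.colon_univ, (hprime 𝔭 h𝔭).radical]
  have hdecomp : Submodule.IsMinimalPrimaryDecomposition (sInf (s : Set (Ideal R))) s :=
    { inf_eq := Finset.inf_id_eq_sInf s
      primary := fun _ h => (hprime _ h).isPrimary
      distinct := fun 𝔭 h𝔭 𝔮 h𝔮 hne => by
        simpa only [Function.onFun, hrad h𝔭, hrad h𝔮] using hne
      minimal := fun 𝔭 h𝔭 hle => by
        obtain ⟨𝔮, h𝔮, h𝔮𝔭⟩ := (hprime 𝔭 h𝔭).inf_le'.1 hle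
        obtain ⟨hne, h𝔮⟩ := Finset.mem_erase.1 h𝔮
        exact hanti h𝔮 h𝔭 hne h𝔮𝔭 }
  calc associatedPrimes R (R ⧸ sInf (s : Set (Ideal R)))
      = (fun 𝔭 : Ideal R => (Submodule.colon 𝔭 (Set.univ : Set R)).radical) '' s := by
        rw [associatedPrimes_quotient, hdecomp.image_radical_eq_associated_primes]
    _ = id '' s := Set.image_congr fun _ => hrad
    _ = s := Set.image_id _

end AssociatedPrimes

section VariableIdeal

variable {R V : Type*}

/-- The ideal of a polynomial ring generated by the variables with indices in `C`. -/
noncomputable def variableIdeal (R : Type*) [CommSemiring R] {V : Type*} (C : Set V) :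
    Ideal (MvPolynomial V R) :=
  Ideal.span (MvPolynomial.X '' C)

section CommSemiring

variable [CommSemiring R]

theorem mem_variableIdeal {C : Set V} {f : MvPolynomial V R} :
    f ∈ variableIdeal R C ↔ ∀ m ∈ f.support, ∃ i ∈ C, m i ≠ 0 :=
  MvPolynomial.mem_ideal_span_X_image

theorem X_mem_variableIdeal [Nontrivial R] {C : Set V} {i : V} :
    MvPolynomial.X i ∈ variableIdeal R C ↔ i ∈ C := by
  classical
  simp [mem_variableIdeal, MvPolynomial.support_X, Finsupp.single_apply]

theorem variableIdeal_le_variableIdeal [Nontrivial R] {C D : Set V} :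
    variableIdeal R C ≤ variableIdeal R D ↔ C ⊆ D :=
  ⟨fun h _ hi => X_mem_variableIdeal.1 (h (X_mem_variableIdeal.2 hi)),
    fun h => Ideal.span_mono (Set.image_mono h)⟩

end CommSemiring

theorem ker_killCompl_val [CommRing R] (C : Set V) :
    RingHom.ker (MvPolynomial.killCompl (R := R) (Subtype.val_injective (p := (· ∉ C)))) =
      variableIdeal R C := by
  ext f
  simp only [RingHom.mem_ker, MvPolynomial.ext_iff, MvPolynomial.coeff_killCompl,
    MvPolynomial.coeff_zero, mem_variableIdeal]
  constructor
  · intro h m hm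
    by_contra! hC
    refine MvPolynomial.mem_support_iff.1 hm ?_
    rw [← Finsupp.mapDomain_comapDomain _ Subtype.val_injective m fun i hi => ?_]
    · exact h _
    · exact ⟨⟨i, fun hiC => Finsupp.mem_support_iff.1 hi (hC i hiC)⟩, rfl⟩
  · intro h m
    by_contra hm
    obtain ⟨i, hi, hmi⟩ := h _ (MvPolynomial.mem_support_iff.2 hm)
    obtain ⟨j, rfl⟩ := Finsupp.mem_range_of_mapDomain_ne_zero hmi
    exact j.2 hi

instance isPrime_variableIdeal [CommRing R] [IsDomain R] (C : Set V) :
    (variableIdeal R C).IsPrime :=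
  ker_killCompl_val (R := R) C ▸ RingHom.ker_isPrime _

theorem height_variableIdeal [CommRing R] [IsDomain R] [IsNoetherianRing R] [Finite V]
    (C : Finset V) : (variableIdeal R (C : Set V)).height = C.card := by
  classical
  apply le_antisymm
  · have hmin : variableIdeal R (C : Set V) ∈ (Ideal.span
        ((C.image MvPolynomial.X : Finset (MvPolynomial V R)) : Set _)).minimalPrimes := by
      rw [Finset.coe_image, ← variableIdeal, Ideal.minimalPrimes_eq_subsingleton_self]
      rfl
    exact (Ideal.height_le_card_of_mem_minimalPrimes_span_finset hmin).trans
      (mod_cast Finset.card_image_le)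
  · induction C using Finset.induction_on with
    | empty => simp
    | insert a C ha ih =>
      have hlt : variableIdeal R (C : Set V) < variableIdeal R (insert a C : Finset V) := by
        refine lt_of_le_not_ge (variableIdeal_le_variableIdeal.2 (by simp)) fun h => ha ?_
        exact_mod_cast variableIdeal_le_variableIdeal.1 h (Finset.mem_insert_self a C)
      rw [Finset.card_insert_of_notMem ha, Nat.cast_add, Nat.cast_one]
      exact (add_le_add_left ih 1).trans (Ideal.height_add_one_le_of_lt_of_isPrime hlt)

end VariableIdeal

section EdgeIdeal

variable {K : Type*} [Field K] {V ι κ : Type*} {E : ι → Finset V}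

/-- The ideal generated by the squarefree monomials `x_F`, where `F` runs through a family `E` of
finite sets of variables: the edge ideal of the hypergraph with edges `E i`. -/
noncomputable def edgeIdeal (K : Type*) [Field K] {V ι : Type*} (E : ι → Finset V) :
    Ideal (MvPolynomial V K) :=
  Ideal.span (Set.range fun i => squarefreeMonomial K (E i))

/-- A transversal (or vertex cover) of a hypergraph: a set of vertices that meets every edge. -/
def IsTransversal (E : ι → Finset V) (C : Finset V) : Prop :=
  ∀ i, ∃ v ∈ E i, v ∈ C

theorem squarefreeMonomial_eq_monomial (F : Finset V) :
    squarefreeMonomial K F = MvPolynomial.monomial (∑ v ∈ F, Finsupp.single v 1) 1 := by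
  rw [squarefreeMonomial, MvPolynomial.monomial_sum_one]
  rfl

theorem sum_single_one_apply [DecidableEq V] (F : Finset V) (v : V) :
    (∑ w ∈ F, Finsupp.single w 1 : V →₀ ℕ) v = if v ∈ F then 1 else 0 := by
  simp [Finsupp.finsetSum_apply, Finsupp.single_apply]

theorem support_sum_single_one (F : Finset V) :
    (∑ v ∈ F, Finsupp.single v 1 : V →₀ ℕ).support = F := by
  classical
  ext v
  simp [sum_single_one_apply]

theorem sum_single_one_le_iff {F : Finset V} {m : V →₀ ℕ} :
    ∑ v ∈ F, Finsupp.single v 1 ≤ m ↔ F ⊆ m.support := by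
  classical
  refine forall_congr' fun v => ?_
  rw [sum_single_one_apply, Finsupp.mem_support_iff, ← Nat.one_le_iff_ne_zero]
  split_ifs with hv <;> simp [hv]

theorem mem_edgeIdeal {f : MvPolynomial V K} :
    f ∈ edgeIdeal K E ↔ ∀ m ∈ f.support, ∃ i, E i ⊆ m.support := by
  have h : edgeIdeal K E = Ideal.span ((fun m => MvPolynomial.monomial m (1 : K)) ''
      Set.range fun i => ∑ v ∈ E i, Finsupp.single v 1) := by
    simp only [edgeIdeal, ← Set.range_comp, squarefreeMonomial_eq_monomial, Function.comp_def]
  simp only [h, MvPolynomial.mem_ideal_span_monomial_image, Set.exists_range_iff,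
    sum_single_one_le_iff]

theorem squarefreeMonomial_mem_edgeIdeal {F : Finset V} :
    squarefreeMonomial K F ∈ edgeIdeal K E ↔ ∃ i, E i ⊆ F := by
  classical
  rw [mem_edgeIdeal, squarefreeMonomial_eq_monomial, MvPolynomial.support_monomial,
    if_neg one_ne_zero]
  simp only [Finset.mem_singleton, forall_eq, support_sum_single_one]

theorem isTransversal_compl_iff [Fintype V] [DecidableEq V] {F : Finset V} :
    IsTransversal E Fᶜ ↔ ∀ i, ¬ E i ⊆ F := by
  simp only [IsTransversal, Finset.not_subset, Finset.mem_compl]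

/-- The variable ideals of the minimal transversals of a hypergraph. -/
def transversalIdeals (K : Type*) [Field K] {V ι : Type*} (E : ι → Finset V) :
    Set (Ideal (MvPolynomial V K)) :=
  (fun C : Finset V => variableIdeal K (C : Set V)) '' {C | Minimal (IsTransversal E) C}

theorem edgeIdeal_eq_sInf [Finite V] : edgeIdeal K E = sInf (transversalIdeals K E) := by
  classical
  have := Fintype.ofFinite V
  refine le_antisymm (le_sInf ?_) fun f hf => mem_edgeIdeal.2 fun m hm => ?_
  · rintro _ ⟨C, hC, rfl⟩ f hf
    refine mem_variableIdeal.2 fun m hm => ?_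
    obtain ⟨i, hi⟩ := mem_edgeIdeal.1 hf m hm
    obtain ⟨v, hv, hvC⟩ := hC.prop i
    exact ⟨v, hvC, Finsupp.mem_support_iff.1 (hi hv)⟩
  · by_contra! hE
    obtain ⟨C, hCm, hC⟩ :=
      exists_minimal_le_of_wellFoundedLT _ _ (isTransversal_compl_iff.2 hE)
    obtain ⟨v, hv, hvm⟩ :=
      mem_variableIdeal.1 (Submodule.mem_sInf.1 hf _ ⟨C, hC, rfl⟩) m hm
    exact Finset.mem_compl.1 (hCm hv) (Finsupp.mem_support_iff.2 hvm)

theorem associatedPrimes_edgeIdeal [Finite V] :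
    associatedPrimes (MvPolynomial V K) (MvPolynomial V K ⧸ edgeIdeal K E) =
      transversalIdeals K E := by
  rw [edgeIdeal_eq_sInf]
  refine associatedPrimes_quotient_sInf ((Set.toFinite _).image _) ?_ ?_
  · rintro _ ⟨C, hC, rfl⟩ _ ⟨D, hD, rfl⟩ hne hle
    have hCD : C ⊆ D := mod_cast variableIdeal_le_variableIdeal.1 hle
    exact hne (congrArg (fun C : Finset V => variableIdeal K (C : Set V))
      (hD.eq_of_le hC.prop hCD))
  · rintro _ ⟨C, -, rfl⟩
    infer_instance

theorem isUnmixed_edgeIdeal_iff [Finite V] :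
    IsUnmixed (edgeIdeal K E) ↔ ∀ C, Minimal (IsTransversal E) C →
      ∀ D, Minimal (IsTransversal E) D → C.card = D.card := by
  simp only [IsUnmixed, associatedPrimes_edgeIdeal, transversalIdeals, Set.forall_mem_image,
    height_variableIdeal, Nat.cast_inj, Set.mem_ofPred_eq]

theorem alexanderDual_edgeIdeal [Fintype V] [DecidableEq V] {E' : κ → Finset V}
    (h : ∀ C, IsTransversal E C ↔ ∃ j, E' j ⊆ C) :
    alexanderDual (edgeIdeal K E) = edgeIdeal K E' := by
  have hnonface (F : Finset V) :
      F ∉ dualComplex (stanleyReisnerComplex (edgeIdeal K E)) ↔ IsTransversal E F := by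
    change ¬ ¬ squarefreeMonomial K Fᶜ ∉ edgeIdeal K E ↔ _
    rw [not_not, squarefreeMonomial_mem_edgeIdeal, not_exists, ← isTransversal_compl_iff,
      compl_compl]
  simp only [alexanderDual, stanleyReisnerIdeal, hnonface, h]
  refine le_antisymm (Ideal.span_le.2 ?_) (Ideal.span_mono ?_)
  · rintro _ ⟨F, hF, rfl⟩
    exact squarefreeMonomial_mem_edgeIdeal.2 hF
  · rintro _ ⟨j, rfl⟩
    exact Set.mem_image_of_mem _ ⟨j, subset_rfl⟩

theorem switchIndices_edgeIdeal {V W : Type*} (E : ι → Finset (V × W)) :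
    switchIndices (edgeIdeal K E) =
      edgeIdeal K fun i => (E i).map (Equiv.prodComm V W).toEmbedding := by
  rw [switchIndices, edgeIdeal, edgeIdeal, Ideal.map_span, ← Set.range_comp]
  simp [Function.comp_def, squarefreeMonomial]

end EdgeIdeal

section MonotoneSelection

variable {P Q : Type*} [Preorder P] [Preorder Q] {F G : P → Q → Prop} {U : Set P}

/-- The relation `G` has a monotone selection on `U` if some monotone function `φ` on `U` satisfies
`G x (φ x)` for all `x ∈ U`. The function is defined on `U` only, since `Q` may be empty. -/
def HasMonotoneSelection (G : P → Q → Prop) (U : Set P) : Prop :=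
  ∃ φ : U →o Q, ∀ x : U, G x (φ x)

theorem HasMonotoneSelection.imp (hFG : ∀ x y, F x y → G x y) (h : HasMonotoneSelection F U) :
    HasMonotoneSelection G U :=
  let ⟨φ, hφ⟩ := h
  ⟨φ, fun x => hFG x _ (hφ x)⟩

theorem hasMonotoneSelection_of_orderHom (φ : P →o Q) (hφ : ∀ x ∈ U, G x (φ x)) :
    HasMonotoneSelection G U :=
  ⟨φ.comp (OrderHom.Subtype.val U), fun x => hφ x x.2⟩

theorem hasMonotoneSelection_univ :
    HasMonotoneSelection G Set.univ ↔ ∃ φ : P →o Q, ∀ x, G x (φ x) :=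
  ⟨fun ⟨φ, hφ⟩ => ⟨⟨fun x => φ ⟨x, trivial⟩, fun _ _ h => φ.monotone h⟩, fun x => hφ ⟨x, trivial⟩⟩,
    fun ⟨φ, hφ⟩ => hasMonotoneSelection_of_orderHom φ fun x _ => hφ x⟩

/-- Selections on the blocks `B x` of a decomposition of `U` need no adjustment to be glued, because
comparable elements lie in the same block. -/
theorem hasMonotoneSelection_of_blocks (B : P → Set P) (hmem : ∀ x ∈ U, x ∈ B x)
    (heq : ∀ x ∈ U, ∀ y ∈ U, x ≤ y → B x = B y) (h : ∀ x ∈ U, HasMonotoneSelection G (B x)) :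
    HasMonotoneSelection G U := by
  have hB : ∀ W ∈ B '' U, HasMonotoneSelection G W := Set.forall_mem_image.2 h
  choose φ hφ using hB
  have hmono : ∀ (W : Set P) hW (W' : Set P) hW', W = W' → ∀ (x : W) (y : W'), (x : P) ≤ y →
      φ W hW x ≤ φ W' hW' y := by
    rintro W hW _ _ rfl x y hxy
    exact (φ W hW).monotone hxy
  have hBU (x : U) : B x ∈ B '' U := Set.mem_image_of_mem B x.2
  exact ⟨⟨fun x => φ _ (hBU x) ⟨x, hmem x x.2⟩,
    fun x y hxy => hmono _ _ _ _ (heq x x.2 y y.2 hxy) _ _ hxy⟩,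
    fun x => hφ _ (hBU x) ⟨x, hmem x x.2⟩⟩

end MonotoneSelection

section Rooted

variable {P Q : Type*} [PartialOrder P]

theorem IsRooted.le_or_le (hP : IsRooted P) {a b c : P} (ha : a ≤ c) (hb : b ≤ c) :
    a ≤ b ∨ b ≤ a := by
  by_contra! h
  refine hP a b h ⟨c, lt_of_le_of_ne ha ?_, lt_of_le_of_ne hb ?_⟩
  · rintro rfl
    exact h.2 hb
  · rintro rfl
    exact h.1 ha

/-- Every element of `U` lies above a unique minimal element of `U`, so the sets `Set.Ici m`, with
`m` minimal in `U`, have no comparabilities between them. -/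
theorem IsRooted.hasMonotoneSelection_of_Ici [Preorder Q] [WellFoundedLT P] (hP : IsRooted P)
    {U : Set P} {G : P → Q → Prop} (h : ∀ p ∈ U, HasMonotoneSelection G (Set.Ici p)) :
    HasMonotoneSelection G U := by
  have hroot (x : P) (hx : x ∈ U) : ∃ m ≤ x, Minimal (· ∈ U) m :=
    exists_minimal_le_of_wellFoundedLT (· ∈ U) x hx
  choose! root hle hmin using hroot
  refine hasMonotoneSelection_of_blocks (fun x => Set.Ici (root x)) hle
    (fun x hx y hy hxy => congrArg Set.Ici ?_) fun x hx => h _ (hmin x hx).prop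
  rcases hP.le_or_le ((hle x hx).trans hxy) (hle y hy) with hxy | hyx
  · exact (hmin y hy).eq_of_le (hmin x hx).prop hxy
  · exact ((hmin x hx).eq_of_le (hmin y hy).prop hyx).symm

theorem IsRooted.hasMonotoneSelection_Ici [Preorder Q] [WellFoundedLT P] (hP : IsRooted P)
    {G : P → Q → Prop} {p : P} {q : Q} (hpq : G p q)
    (h : ∀ p' > p, HasMonotoneSelection (fun x y => q ≤ y ∧ G x y) (Set.Ici p')) :
    HasMonotoneSelection (fun x y => q ≤ y ∧ G x y) (Set.Ici p) := by
  classical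
  obtain ⟨φ, hφ⟩ := hP.hasMonotoneSelection_of_Ici (U := Set.Ioi p) h
  have hlt {x : P} (hx : x ∈ Set.Ici p) (hne : x ≠ p) : x ∈ Set.Ioi p := lt_of_le_of_ne hx hne.symm
  let ψ (x : Set.Ici p) : Q := if hx : x.1 = p then q else φ ⟨x, hlt x.2 hx⟩
  have hψ_eq {x : Set.Ici p} (hx : x.1 = p) : ψ x = q := dif_pos hx
  have hψ_ne {x : Set.Ici p} (hx : x.1 ≠ p) : ψ x = φ ⟨x, hlt x.2 hx⟩ := dif_neg hx
  have hψ (x : Set.Ici p) : q ≤ ψ x ∧ G x (ψ x) := by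
    by_cases hx : x.1 = p
    · rw [hψ_eq hx, hx]
      exact ⟨le_rfl, hpq⟩
    · rw [hψ_ne hx]
      exact hφ _
  refine ⟨⟨ψ, fun x y hxy => ?_⟩, hψ⟩
  by_cases hx : x.1 = p
  · rw [hψ_eq hx]
    exact (hψ y).1
  · have hy : y.1 ≠ p := fun hy => hx (le_antisymm (hy.subst (Subtype.coe_le_coe.2 hxy)) x.2)
    rw [hψ_ne hx, hψ_ne hy]
    exact φ.monotone hxy

variable [PartialOrder Q]

theorem IsRooted.hasMonotoneSelection_Ici_or [WellFoundedLT P] [WellFoundedGT P]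
    [WellFoundedLT Q] [WellFoundedGT Q] (hP : IsRooted P) (hQ : IsRooted Q)
    (F : P → Q → Prop) (z : P × Q) :
    HasMonotoneSelection (fun x y => z.2 ≤ y ∧ F x y) (Set.Ici z.1) ∨
      HasMonotoneSelection (fun y x => z.1 ≤ x ∧ ¬ F x y) (Set.Ici z.2) := by
  induction z using WellFoundedGT.induction with
  | _ z ih =>
    obtain ⟨p, q⟩ := z
    by_contra! ⟨hφ, hψ⟩
    by_cases hF : F p q
    · refine hφ (hP.hasMonotoneSelection_Ici hF fun p' hp' => ?_)
      refine (ih (p', q) (Prod.mk_lt_mk_iff_left.2 hp')).resolve_right fun h => hψ ?_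
      exact h.imp fun y x hx => ⟨hp'.le.trans hx.1, hx.2⟩
    · refine hψ (hQ.hasMonotoneSelection_Ici hF fun q' hq' => ?_)
      refine (ih (p, q') (Prod.mk_lt_mk_iff_right.2 hq')).resolve_left fun h => hφ ?_
      exact h.imp fun x y hy => ⟨hq'.le.trans hy.1, hy.2⟩

theorem IsRooted.hasMonotoneSelection_Ici_or_univ [WellFoundedLT P] [WellFoundedGT P]
    [WellFoundedLT Q] [WellFoundedGT Q] (hP : IsRooted P) (hQ : IsRooted Q)
    (F : P → Q → Prop) (p : P) :
    HasMonotoneSelection F (Set.Ici p) ∨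
      HasMonotoneSelection (fun y x => p ≤ x ∧ ¬ F x y) Set.univ := by
  refine or_iff_not_imp_left.2 fun hF => hQ.hasMonotoneSelection_of_Ici fun q _ => ?_
  exact (hP.hasMonotoneSelection_Ici_or hQ F (p, q)).resolve_left fun h =>
    hF (h.imp fun _ _ => And.right)

end Rooted

section Corooted

variable {P Q : Type*} [PartialOrder P]

theorem isRooted_orderDual : IsRooted Pᵒᵈ ↔ IsCorooted P :=
  ⟨fun h a b hab => h (OrderDual.toDual a) (OrderDual.toDual b) hab.symm,
    fun h a b hab => h (OrderDual.ofDual a) (OrderDual.ofDual b) hab.symm⟩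

theorem isCorooted_orderDual : IsCorooted Pᵒᵈ ↔ IsRooted P :=
  isRooted_orderDual.symm

theorem IsCorooted.le_or_le (hP : IsCorooted P) {a b c : P} (ha : c ≤ a) (hb : c ≤ b) :
    a ≤ b ∨ b ≤ a :=
  ((isRooted_orderDual.2 hP).le_or_le (c := OrderDual.toDual c) ha hb).symm

/-- If no selection of `F` on `Set.Ici p` exists, let `ψ y` be the largest `x ≥ p` such that `F` has
no selection on `Set.Ici x` with values above `y`. Then `ψ` is monotone since `Set.Ici p` is a
chain, and `F (ψ y) y` fails since otherwise `y` could be selected at `ψ y`. -/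
theorem IsRooted.hasMonotoneSelection_Ici_or_univ_of_isCorooted [Preorder Q] [WellFoundedLT P]
    [WellFoundedGT P] (hP : IsRooted P) (hP' : IsCorooted P) (F : P → Q → Prop) (p : P) :
    HasMonotoneSelection F (Set.Ici p) ∨
      HasMonotoneSelection (fun y x => p ≤ x ∧ ¬ F x y) Set.univ := by
  refine or_iff_not_imp_left.2 fun hF => ?_
  let Obstructed (y : Q) (x : P) : Prop :=
    p ≤ x ∧ ¬ HasMonotoneSelection (fun x' y' => y ≤ y' ∧ F x' y') (Set.Ici x)
  have hp (y : Q) : Obstructed y p := ⟨le_rfl, fun h => hF (h.imp fun _ _ => And.right)⟩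
  choose ψ _ hψ using fun y => exists_maximal_ge_of_wellFoundedGT (Obstructed y) p (hp y)
  refine hasMonotoneSelection_univ.2 ⟨⟨ψ, fun y y' hyy' => ?_⟩, fun y => ⟨(hψ y).prop.1, ?_⟩⟩
  · have hψy : Obstructed y' (ψ y) := ⟨(hψ y).prop.1, fun h =>
      (hψ y).prop.2 (h.imp fun _ _ h => ⟨hyy'.trans h.1, h.2⟩)⟩
    exact (hP'.le_or_le hψy.1 (hψ y').prop.1).elim id fun h => (hψ y').le_of_ge hψy h
  · refine fun hFy => (hψ y).prop.2 (hP.hasMonotoneSelection_Ici hFy fun x hx => ?_)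
    by_contra hsel
    exact (hψ y).not_prop_of_gt hx ⟨(hψ y).prop.1.trans hx.le, hsel⟩

end Corooted

section Components

variable {P Q : Type*}

/-- Two elements are linked if they lie in the same connected component of the poset. -/
def Linked [Preorder P] (a b : P) : Prop :=
  Relation.EqvGen (· ≤ ·) a b

/-- The values of `ψ` lie in a single connected component of `P`. A component is asked for even if
`Q` is empty, so this fails for empty `P`. -/
def MapsIntoComponent [Preorder P] (ψ : Q → P) : Prop :=
  ∃ p, ∀ y, Linked p (ψ y)

section Preorder

variable [Preorder P] [Preorder Q] {a b c : P}

theorem Linked.of_le (h : a ≤ b) : Linked a b :=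
  Relation.EqvGen.rel _ _ h

theorem Linked.symm (h : Linked a b) : Linked b a :=
  Relation.EqvGen.symm _ _ h

theorem Linked.trans (hab : Linked a b) (hbc : Linked b c) : Linked a c :=
  Relation.EqvGen.trans _ _ _ hab hbc

theorem Linked.map (h : Linked a b) (φ : P →o Q) : Linked (φ a) (φ b) := by
  induction h with
  | rel a b h => exact .of_le (φ.monotone h)
  | refl a => exact .refl _
  | symm a b _ ih => exact ih.symm
  | trans a b c _ _ ihab ihbc => exact ihab.trans ihbc

theorem Linked.dual (h : Linked a b) : Linked (OrderDual.toDual a) (OrderDual.toDual b) := by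
  induction h with
  | rel a b h => exact Linked.symm (.of_le (OrderDual.toDual_le_toDual.2 h))
  | refl a => exact .refl _
  | symm a b _ ih => exact ih.symm
  | trans a b c _ _ ihab ihbc => exact ihab.trans ihbc

theorem hasMonotoneSelection_univ_of_components {G : P → Q → Prop}
    (h : ∀ p, HasMonotoneSelection G {x | Linked p x}) : HasMonotoneSelection G Set.univ :=
  hasMonotoneSelection_of_blocks (fun p => {x | Linked p x}) (fun _ _ => .refl _)
    (fun _ _ _ _ hxy => Set.ext fun _ =>
      ⟨(Linked.of_le hxy).symm.trans, (Linked.of_le hxy).trans⟩) fun p _ => h p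

end Preorder

theorem IsConnected.linked [PartialOrder P] (hP : IsConnected P) (a b : P) : Linked a b := by
  obtain ⟨w⟩ := SimpleGraph.Connected.preconnected hP a b
  induction w with
  | nil => exact .refl _
  | cons h _ ih =>
    rcases h with h | h
    · exact (Linked.of_le h.le).trans ih
    · exact (Linked.of_le h.le).symm.trans ih

theorem mapsIntoComponent_of_isConnected [PartialOrder P] [PartialOrder Q]
    (h : IsConnected P ∨ IsConnected Q) (ψ : Q →o P) : MapsIntoComponent ψ := by
  rcases h with hP | hQ
  · obtain ⟨p⟩ := SimpleGraph.Connected.nonempty hP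
    exact ⟨p, fun y => hP.linked p (ψ y)⟩
  · obtain ⟨q⟩ := SimpleGraph.Connected.nonempty hQ
    exact ⟨ψ q, fun y => (hQ.linked q y).map ψ⟩

end Components

section CompatiblePairs

variable {P Q : Type*} [PartialOrder P] [PartialOrder Q]

theorem IsDisjointUnionOfChains.exists_isChain (hP : IsDisjointUnionOfChains P) (c : P) :
    ∃ A : Set P, IsChain (· ≤ ·) A ∧ ∀ x, x ≤ c ∨ c ≤ x → x ∈ A := by
  obtain ⟨C, hC, hchain, hpair⟩ := hP
  obtain ⟨A, ⟨hA, hcA⟩, -⟩ := hC.2 c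
  refine ⟨A, hchain A hA, fun x hx => ?_⟩
  obtain ⟨B, ⟨hB, hxB⟩, -⟩ := hC.2 x
  suffices A = B from this ▸ hxB
  by_contra hne
  exact hx.elim (hpair hB hA (Ne.symm hne) x hxB c hcA) (hpair hA hB hne c hcA x hxB)

theorem isDisjointUnionOfChains_of_isRooted_of_isCorooted (hP : IsRooted P)
    (hP' : IsCorooted P) : IsDisjointUnionOfChains P := by
  let comparable : Setoid P :=
    { r := fun a b => a ≤ b ∨ b ≤ a
      iseqv :=
        { refl := fun a => Or.inl le_rfl
          symm := Or.symm
          trans := by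
            rintro a b c (hab | hba) (hbc | hcb)
            · exact Or.inl (hab.trans hbc)
            · exact hP.le_or_le hab hcb
            · exact hP'.le_or_le hba hbc
            · exact Or.inr (hcb.trans hba) } }
  refine ⟨comparable.classes, comparable.isPartition_classes, ?_, ?_⟩
  · rintro _ ⟨c, rfl⟩ a ha b hb -
    exact comparable.trans' ha (comparable.symm' hb)
  · intro A hA B hB hne a ha b hb hab
    obtain ⟨D, hD, haD, hbD⟩ := comparable.rel_iff_exists_classes.1 (Or.inl hab : comparable a b)
    exact hne ((Setoid.eq_of_mem_classes hA ha hD haD).trans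
      (Setoid.eq_of_mem_classes hD hbD hB hb))

theorem isDisjointUnionOfChains_iff :
    IsDisjointUnionOfChains P ↔ IsRooted P ∧ IsCorooted P := by
  refine ⟨fun hP => ⟨fun a b hab ⟨c, hac, hbc⟩ => ?_, fun a b hab ⟨c, hca, hcb⟩ => ?_⟩,
    fun h => isDisjointUnionOfChains_of_isRooted_of_isCorooted h.1 h.2⟩ <;>
  obtain ⟨A, hA, hcA⟩ := hP.exists_isChain c
  · exact (hA.total (hcA a (Or.inl hac.le)) (hcA b (Or.inl hbc.le))).elim hab.1 hab.2
  · exact (hA.total (hcA a (Or.inr hca.le)) (hcA b (Or.inr hcb.le))).elim hab.1 hab.2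

/-- The condition on `(P, Q)` that characterizes unmixedness of `L(P, Q)`, in the form in which it
enters the proofs: its negation provides a fork in one of the posets and an opposite fork in the
other. -/
def IsCompatiblePair (P Q : Type*) [PartialOrder P] [PartialOrder Q] : Prop :=
  (IsRooted P ∨ IsCorooted Q) ∧ (IsCorooted P ∨ IsRooted Q)

theorem isCompatiblePair_iff :
    IsCompatiblePair P Q ↔ (IsRooted P ∧ IsRooted Q) ∨ (IsCorooted P ∧ IsCorooted Q) ∨
      (IsDisjointUnionOfChains P ∨ IsDisjointUnionOfChains Q) := by
  rw [isDisjointUnionOfChains_iff, isDisjointUnionOfChains_iff, IsCompatiblePair]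
  tauto

section Dichotomy

variable {F : P → Q → Prop}

theorem IsRooted.exists_orderHom_or [WellFoundedLT P] (hP : IsRooted P)
    (h : ∀ p, HasMonotoneSelection F (Set.Ici p) ∨
      HasMonotoneSelection (fun y x => p ≤ x ∧ ¬ F x y) Set.univ) :
    (∃ φ : P →o Q, ∀ x, F x (φ x)) ∨ ∃ ψ : Q →o P, MapsIntoComponent ψ ∧ ∀ y, ¬ F (ψ y) y := by
  by_cases hF : ∀ p, HasMonotoneSelection F (Set.Ici p)
  · exact Or.inl (hasMonotoneSelection_univ.1 (hP.hasMonotoneSelection_of_Ici fun p _ => hF p))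
  · obtain ⟨p, hp⟩ := not_forall.1 hF
    obtain ⟨ψ, hψ⟩ := hasMonotoneSelection_univ.1 ((h p).resolve_left hp)
    exact Or.inr ⟨ψ, ⟨p, fun y => .of_le (hψ y).1⟩, fun y => (hψ y).2⟩

theorem IsCorooted.exists_orderHom_or [WellFoundedLT P] [WellFoundedGT P] [WellFoundedLT Q]
    [WellFoundedGT Q] (hP : IsCorooted P) (hQ : IsCorooted Q) :
    (∃ φ : P →o Q, ∀ x, F x (φ x)) ∨ ∃ ψ : Q →o P, MapsIntoComponent ψ ∧ ∀ y, ¬ F (ψ y) y := by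
  have hP' := isRooted_orderDual.2 hP
  have hQ' := isRooted_orderDual.2 hQ
  rcases hP'.exists_orderHom_or (hP'.hasMonotoneSelection_Ici_or_univ hQ'
    fun x y => F (OrderDual.ofDual x) (OrderDual.ofDual y)) with ⟨φ, hφ⟩ | ⟨ψ, ⟨p, hp⟩, hψ⟩
  · exact Or.inl ⟨OrderHom.dual.symm φ, fun x => hφ (OrderDual.toDual x)⟩
  · refine Or.inr ⟨OrderHom.dual.symm ψ, ⟨OrderDual.ofDual p, fun y => ?_⟩,
      fun y => hψ (OrderDual.toDual y)⟩
    exact (hp (OrderDual.toDual y)).dual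

/-- The selections of the complement of `F` are built one component of `P` at a time: if for every
component they fail on some `Set.Ici q`, then `F` has a selection over every component. -/
theorem exists_orderHom_or_of_isRooted_of_isCorooted [WellFoundedLT Q] [WellFoundedGT Q]
    (hQ : IsRooted Q) (hQ' : IsCorooted Q) :
    (∃ φ : P →o Q, ∀ x, F x (φ x)) ∨ ∃ ψ : Q →o P, MapsIntoComponent ψ ∧ ∀ y, ¬ F (ψ y) y := by
  by_cases hF : ∃ p, ∀ q, HasMonotoneSelection (fun y x => Linked p x ∧ ¬ F x y) (Set.Ici q)
  · obtain ⟨p, hp⟩ := hF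
    obtain ⟨ψ, hψ⟩ :=
      hasMonotoneSelection_univ.1 (hQ.hasMonotoneSelection_of_Ici fun q _ => hp q)
    exact Or.inr ⟨ψ, ⟨p, fun y => (hψ y).1⟩, fun y => (hψ y).2⟩
  · refine Or.inl (hasMonotoneSelection_univ.1 ?_)
    refine hasMonotoneSelection_univ_of_components fun p => ?_
    obtain ⟨q, hq⟩ := not_forall.1 (not_exists.1 hF p)
    obtain ⟨φ, hφ⟩ := hasMonotoneSelection_univ.1
      ((hQ.hasMonotoneSelection_Ici_or_univ_of_isCorooted hQ' _ q).resolve_left hq)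
    exact hasMonotoneSelection_of_orderHom φ fun x hx => not_not.1 fun h => (hφ x).2 ⟨hx, h⟩

theorem IsCompatiblePair.exists_orderHom_or [WellFoundedLT P] [WellFoundedGT P]
    [WellFoundedLT Q] [WellFoundedGT Q] (h : IsCompatiblePair P Q) (F : P → Q → Prop) :
    (∃ φ : P →o Q, ∀ x, F x (φ x)) ∨ ∃ ψ : Q →o P, MapsIntoComponent ψ ∧ ∀ y, ¬ F (ψ y) y := by
  obtain ⟨hP | hQ', hP' | hQ⟩ := h
  · exact hP.exists_orderHom_or (hP.hasMonotoneSelection_Ici_or_univ_of_isCorooted hP' F)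
  · exact hP.exists_orderHom_or (hP.hasMonotoneSelection_Ici_or_univ hQ F)
  · exact hP'.exists_orderHom_or hQ'
  · exact exists_orderHom_or_of_isRooted_of_isCorooted hQ hQ'

end Dichotomy

section FixedPoints

theorem exists_isFixedPt_of_le [WellFoundedGT P] (f : P →o P) {x : P} (hx : x ≤ f x) :
    ∃ y, Function.IsFixedPt f y := by
  obtain ⟨y, -, hy⟩ := exists_maximal_ge_of_wellFoundedGT (fun y => y ≤ f y) x hx
  exact ⟨y, (hy.eq_of_le (f.monotone hy.prop) hy.prop).symm⟩

theorem IsRooted.le_of_linked (hP : IsRooted P) {m a b : P} (hm : IsMin m) (h : Linked a b) :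
    m ≤ a → m ≤ b := by
  suffices m ≤ a ↔ m ≤ b from this.1
  induction h with
  | rel a b h => exact ⟨h.trans', fun hmb => (hP.le_or_le hmb h).elim id fun ham => hm ham⟩
  | refl a => exact Iff.rfl
  | symm a b _ ih => exact ih.symm
  | trans a b c _ _ ihab ihbc => exact ihab.trans ihbc

/-- The component of `p` has a least element, and `f` maps this component to itself. -/
theorem IsRooted.exists_isFixedPt [WellFoundedLT P] [WellFoundedGT P] (hP : IsRooted P)
    (f : P →o P) {p : P} (hp : Linked p (f p)) : ∃ x, Function.IsFixedPt f x := by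
  obtain ⟨m, hmp, hm⟩ := exists_minimal_le_of_wellFoundedLT (fun _ => True) p trivial
  have hmf : Linked p (f m) := hp.trans (Linked.of_le (f.monotone hmp)).symm
  exact exists_isFixedPt_of_le f (hP.le_of_linked (minimal_true.1 hm) hmf hmp)

theorem IsCorooted.exists_isFixedPt [WellFoundedLT P] [WellFoundedGT P] (hP : IsCorooted P)
    (f : P →o P) {p : P} (hp : Linked p (f p)) : ∃ x, Function.IsFixedPt f x :=
  (isRooted_orderDual.2 hP).exists_isFixedPt f.dual hp.dual

theorem MapsIntoComponent.exists_apply_apply_eq [WellFoundedLT P] [WellFoundedGT P]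
    [WellFoundedLT Q] [WellFoundedGT Q] (h : IsRooted P ∨ IsCorooted Q) {ψ : Q →o P}
    (hψ : MapsIntoComponent ψ) (φ : P →o Q) : ∃ x, ψ (φ x) = x := by
  obtain ⟨p, hp⟩ := hψ
  rcases h with hP | hQ
  · exact hP.exists_isFixedPt (ψ.comp φ) (hp (φ p))
  · obtain ⟨y, hy⟩ := hQ.exists_isFixedPt (φ.comp ψ) ((hp (φ p)).map φ)
    exact ⟨ψ y, congrArg ψ hy⟩

end FixedPoints

end CompatiblePairs

section Covers

variable {P Q : Type*} [Preorder P] [Preorder Q]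

/-- The graph of a monotone map, a finite set of variables of `K[x_{p,q} : p ∈ P, q ∈ Q]`. -/
def graph [Fintype P] (φ : P →o Q) : Finset (P × Q) :=
  Finset.univ.map ⟨fun x => (x, φ x), fun _ _ h => congrArg Prod.fst h⟩

/-- The graph of a monotone map `Q → P`, transposed to a subset of `P × Q`. -/
def transposedGraph [Fintype Q] (ψ : Q →o P) : Finset (P × Q) :=
  (graph ψ).map (Equiv.prodComm Q P).toEmbedding

/-- A cover is a set of pairs that meets the graph of every monotone map `P → Q`. Unlike
transversality of the family `graph`, this does not need `P` to be a `Fintype`, and it is invariant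
under order duality. -/
def IsCover (C : Finset (P × Q)) : Prop :=
  ∀ φ : P →o Q, ∃ x, (x, φ x) ∈ C

theorem mem_graph [Fintype P] {φ : P →o Q} {x : P} {y : Q} : (x, y) ∈ graph φ ↔ φ x = y := by
  refine Finset.mem_map.trans ⟨?_, ?_⟩
  · rintro ⟨_, -, h⟩
    exact (Prod.mk.inj h).1 ▸ (Prod.mk.inj h).2
  · rintro rfl
    exact ⟨x, Finset.mem_univ x, rfl⟩

theorem mem_transposedGraph [Fintype Q] {ψ : Q →o P} {x : P} {y : Q} :
    (x, y) ∈ transposedGraph ψ ↔ ψ y = x := by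
  simp [transposedGraph, mem_graph]

theorem card_transposedGraph [Fintype Q] (ψ : Q →o P) :
    (transposedGraph ψ).card = Fintype.card Q := by
  simp [transposedGraph, graph]

theorem isTransversal_graph [Fintype P] {C : Finset (P × Q)} :
    IsTransversal (graph (P := P) (Q := Q)) C ↔ IsCover C := by
  simp [IsTransversal, IsCover, mem_graph]

theorem isCover_orderDual {C : Finset (P × Q)} :
    IsCover (P := Pᵒᵈ) (Q := Qᵒᵈ) C ↔ IsCover C :=
  OrderHom.dual.forall_congr_left

theorem IsCover.image_snd_eq_univ [Fintype Q] [DecidableEq Q] {C : Finset (P × Q)}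
    (hC : IsCover C) : C.image Prod.snd = Finset.univ := by
  refine Finset.eq_univ_of_forall fun y => ?_
  obtain ⟨x, hx⟩ := hC (OrderHom.const P y)
  exact Finset.mem_image_of_mem Prod.snd hx

theorem IsCover.card_le [Fintype Q] {C : Finset (P × Q)} (hC : IsCover C) :
    Fintype.card Q ≤ C.card := by
  classical
  rw [← Finset.card_univ, ← hC.image_snd_eq_univ]
  exact Finset.card_image_le

theorem IsCover.card_lt [Fintype Q] {C : Finset (P × Q)} (hC : IsCover C) {x x' : P} {y : Q}
    (hne : x ≠ x') (hx : (x, y) ∈ C) (hx' : (x', y) ∈ C) : Fintype.card Q < C.card := by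
  classical
  refine lt_of_le_of_ne hC.card_le fun hcard => hne ?_
  rw [← Finset.card_univ, ← hC.image_snd_eq_univ] at hcard
  exact congrArg Prod.fst (Finset.card_image_iff.1 hcard hx hx' rfl)

theorem isCover_transposedGraph_const [Fintype Q] (p : P) :
    IsCover (transposedGraph (OrderHom.const Q p)) :=
  fun _ => ⟨p, mem_transposedGraph.2 rfl⟩

theorem minimal_transposedGraph [Fintype Q] {ψ : Q →o P} (hψ : IsCover (transposedGraph ψ)) :
    Minimal IsCover (transposedGraph ψ) :=
  ⟨hψ, fun _ hD hle =>
    (Finset.eq_of_subset_of_card_le hle (card_transposedGraph ψ ▸ hD.card_le)).ge⟩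

end Covers

section StepHom

variable {P Q : Type*} [Preorder P] [Preorder Q]

open Classical in
/-- The monotone map with value `b'` on the up-set of `a` and value `b` elsewhere. -/
noncomputable def stepHom (a : P) {b b' : Q} (h : b ≤ b') : P →o Q where
  toFun x := if a ≤ x then b' else b
  monotone' x y hxy := by
    dsimp only
    split_ifs with hx hy hy
    exacts [le_rfl, absurd (hx.trans hxy) hy, h, le_rfl]

theorem stepHom_of_le {a x : P} {b b' : Q} (h : b ≤ b') (hx : a ≤ x) : stepHom a h x = b' :=
  if_pos hx

theorem stepHom_of_not_le {a x : P} {b b' : Q} (h : b ≤ b') (hx : ¬ a ≤ x) : stepHom a h x = b :=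
  if_neg hx

end StepHom

section ForkCover

variable {P Q : Type*} [Preorder Q] [Fintype Q] {p p₁ p₂ : P} {q q₁ q₂ : Q}

open Classical in
/-- The cover which expresses that a monotone map `φ` with `q₁ ≤ φ p₁` and `q₂ ≤ φ p₂` has
`q₁ ≤ φ p` and `q₂ ≤ φ p` for every common upper bound `p` of `p₁` and `p₂`. -/
noncomputable def forkCover (p₁ p₂ p : P) (q₁ q₂ : Q) : Finset (P × Q) :=
  {p₁} ×ˢ ({y | ¬ q₁ ≤ y} : Finset Q) ∪ {p₂} ×ˢ ({y | ¬ q₂ ≤ y} : Finset Q) ∪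
    {p} ×ˢ ({y | q₁ ≤ y ∧ q₂ ≤ y} : Finset Q)

theorem mem_forkCover {x : P} {y : Q} : (x, y) ∈ forkCover p₁ p₂ p q₁ q₂ ↔
    (x = p₁ ∧ ¬ q₁ ≤ y) ∨ (x = p₂ ∧ ¬ q₂ ≤ y) ∨ (x = p ∧ q₁ ≤ y ∧ q₂ ≤ y) := by
  simp only [forkCover, Finset.mem_union, Finset.mem_product, Finset.mem_singleton,
    Finset.mem_filter_univ, or_assoc]

theorem forkCover_comm : forkCover p₁ p₂ p q₁ q₂ = forkCover p₂ p₁ p q₂ q₁ := by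
  ext ⟨x, y⟩
  rw [mem_forkCover, mem_forkCover]
  tauto

variable [Preorder P]

theorem isCover_forkCover (hp₁ : p₁ ≤ p) (hp₂ : p₂ ≤ p) :
    IsCover (forkCover p₁ p₂ p q₁ q₂) := by
  intro φ
  by_contra! h
  simp only [mem_forkCover, not_or, not_and, not_not] at h
  exact (h p).2.2 rfl (((h p₁).1 rfl).trans (φ.monotone hp₁))
    (((h p₂).2.1 rfl).trans (φ.monotone hp₂))

theorem IsCover.mem_of_subset_forkCover {D : Finset (P × Q)} (hD : IsCover D)
    (hsub : D ⊆ forkCover p₁ p₂ p q₁ q₂) (hp : ¬ p₂ ≤ p₁) (hp₂ : p₂ ≤ p) (hq : ¬ q₁ ≤ q₂)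
    (hq₂ : q ≤ q₂) : (p₁, q) ∈ D := by
  obtain ⟨x, hx⟩ := hD (stepHom p₂ hq₂)
  rcases mem_forkCover.1 (hsub hx) with ⟨rfl, -⟩ | ⟨rfl, h⟩ | ⟨rfl, h, -⟩
  · rwa [stepHom_of_not_le hq₂ hp] at hx
  · rw [stepHom_of_le hq₂ le_rfl] at h
    exact absurd le_rfl h
  · rw [stepHom_of_le hq₂ hp₂] at h
    exact absurd h hq

end ForkCover

section MinimalCovers

variable {P Q : Type*} [PartialOrder P] [PartialOrder Q]

section Sufficiency

variable [Finite P] [Fintype Q] {C : Finset (P × Q)}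

theorem IsCompatiblePair.isCover_iff (h : IsCompatiblePair P Q) :
    IsCover C ↔ ∃ ψ : Q →o P, MapsIntoComponent ψ ∧ transposedGraph ψ ⊆ C := by
  constructor
  · intro hC
    rcases h.exists_orderHom_or fun x y => (x, y) ∉ C with ⟨φ, hφ⟩ | ⟨ψ, hψ, hψC⟩
    · obtain ⟨x, hx⟩ := hC φ
      exact absurd hx (hφ x)
    · refine ⟨ψ, hψ, fun ⟨x, y⟩ hxy => ?_⟩
      obtain rfl := mem_transposedGraph.1 hxy
      exact not_not.1 (hψC y)
  · rintro ⟨ψ, hψ, hsub⟩ φ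
    obtain ⟨x, hx⟩ := hψ.exists_apply_apply_eq h.1 φ
    exact ⟨x, hsub (mem_transposedGraph.2 hx)⟩

theorem IsCompatiblePair.card_eq_of_minimal_isCover (h : IsCompatiblePair P Q)
    (hC : Minimal IsCover C) : C.card = Fintype.card Q := by
  obtain ⟨ψ, hψ, hsub⟩ := h.isCover_iff.1 hC.prop
  rw [← hC.eq_of_le (h.isCover_iff.2 ⟨ψ, hψ, subset_rfl⟩) hsub, card_transposedGraph]

end Sufficiency

section Necessity

variable [Fintype Q]

theorem exists_minimal_isCover_card_lt_of_not_isRooted (hP : ¬ IsRooted P) (hQ : ¬ IsCorooted Q) :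
    ∃ C : Finset (P × Q), Minimal IsCover C ∧ Fintype.card Q < C.card := by
  simp only [IsRooted, IsCorooted, not_forall, not_not] at hP hQ
  obtain ⟨p₁, p₂, hp, p, hp₁, hp₂⟩ := hP
  obtain ⟨q₁, q₂, hq, q, hq₁, hq₂⟩ := hQ
  obtain ⟨D, hsub, hD⟩ := exists_minimal_le_of_wellFoundedLT IsCover _
    (isCover_forkCover (q₁ := q₁) (q₂ := q₂) hp₁.le hp₂.le)
  have hmem₁ : (p₁, q) ∈ D := hD.prop.mem_of_subset_forkCover hsub hp.2 hp₂.le hq.1 hq₂.le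
  have hmem₂ : (p₂, q) ∈ D :=
    hD.prop.mem_of_subset_forkCover (forkCover_comm.subst hsub) hp.1 hp₁.le hq.2 hq₁.le
  exact ⟨D, hD, hD.prop.card_lt (fun h => hp.1 h.le) hmem₁ hmem₂⟩

theorem exists_minimal_isCover_card_lt_of_not_isCorooted (hP : ¬ IsCorooted P) (hQ : ¬ IsRooted Q) :
    ∃ C : Finset (P × Q), Minimal IsCover C ∧ Fintype.card Q < C.card := by
  obtain ⟨C, hC, hcard⟩ := exists_minimal_isCover_card_lt_of_not_isRooted (P := Pᵒᵈ) (Q := Qᵒᵈ)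
    (mt isRooted_orderDual.1 hP) (mt isCorooted_orderDual.1 hQ)
  exact ⟨C, ⟨isCover_orderDual.1 hC.prop,
    fun D hD hDC => hC.le_of_le (isCover_orderDual.2 hD) hDC⟩, hcard⟩

end Necessity

theorem isCompatiblePair_of_card_eq [Finite Q]
    (h : ∀ C : Finset (P × Q), Minimal IsCover C →
      ∀ D : Finset (P × Q), Minimal IsCover D → C.card = D.card) :
    IsCompatiblePair P Q := by
  have := Fintype.ofFinite Q
  have hle : ¬ ∃ C : Finset (P × Q), Minimal IsCover C ∧ Fintype.card Q < C.card := by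
    rintro ⟨C, hC, hlt⟩
    obtain ⟨⟨p, _⟩, -⟩ := Finset.card_pos.1 (Nat.zero_lt_of_lt hlt)
    have hcard : C.card = _ := h C hC _ (minimal_transposedGraph (isCover_transposedGraph_const p))
    exact hlt.ne' (hcard.trans (card_transposedGraph _))
  constructor <;> by_contra! hPQ
  · exact hle (exists_minimal_isCover_card_lt_of_not_isRooted hPQ.1 hPQ.2)
  · exact hle (exists_minimal_isCover_card_lt_of_not_isCorooted hPQ.1 hPQ.2)

end MinimalCovers

section HomIdeal

variable (K : Type*) [Field K] {P Q : Type*} [PartialOrder P] [Fintype P] [PartialOrder Q]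

theorem L_eq_edgeIdeal :
    L K P Q = edgeIdeal K (graph (P := P) (Q := Q)) := by
  simp only [L, edgeIdeal, squarefreeMonomial, graph, Finset.prod_map]
  rfl

theorem isUnmixed_L_iff [Finite Q] : IsUnmixed (L K P Q) ↔ IsCompatiblePair P Q := by
  have := Fintype.ofFinite Q
  have htransversal : IsTransversal (graph (P := P) (Q := Q)) = IsCover :=
    funext fun _ => propext isTransversal_graph
  rw [L_eq_edgeIdeal, isUnmixed_edgeIdeal_iff, htransversal]
  refine ⟨isCompatiblePair_of_card_eq, fun h C hC D hD => ?_⟩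
  rw [h.card_eq_of_minimal_isCover hC, h.card_eq_of_minimal_isCover hD]

theorem alexanderDual_L [Fintype Q] [DecidableEq P] [DecidableEq Q] (h : IsCompatiblePair P Q)
    (hconn : IsConnected P ∨ IsConnected Q) :
    alexanderDual (L K P Q) = switchIndices (L K Q P) := by
  rw [L_eq_edgeIdeal, L_eq_edgeIdeal, switchIndices_edgeIdeal]
  refine alexanderDual_edgeIdeal fun C => ?_
  rw [isTransversal_graph, h.isCover_iff]
  simp only [mapsIntoComponent_of_isConnected hconn, true_and, transposedGraph]

end HomIdeal

end PosetHomIdeal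

theorem mainTheorem8 (K : Type*) [Field K]
    (P : Type*) [PartialOrder P] [Fintype P] [DecidableEq P]
    (Q : Type*) [PartialOrder Q] [Fintype Q] [DecidableEq Q] :
    (PosetHomIdeal.IsUnmixed (PosetHomIdeal.L K P Q) ↔
      (PosetHomIdeal.IsRooted P ∧ PosetHomIdeal.IsRooted Q) ∨
      (PosetHomIdeal.IsCorooted P ∧ PosetHomIdeal.IsCorooted Q) ∨
      (PosetHomIdeal.IsDisjointUnionOfChains P ∨ PosetHomIdeal.IsDisjointUnionOfChains Q)) ∧
    ((PosetHomIdeal.IsConnected P ∨ PosetHomIdeal.IsConnected Q) →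
      PosetHomIdeal.IsUnmixed (PosetHomIdeal.L K P Q) →
      PosetHomIdeal.alexanderDual (PosetHomIdeal.L K P Q) =
        PosetHomIdeal.switchIndices (PosetHomIdeal.L K Q P)) :=
  ⟨(PosetHomIdeal.isUnmixed_L_iff K).trans PosetHomIdeal.isCompatiblePair_iff, fun hconn h =>
    PosetHomIdeal.alexanderDual_L K ((PosetHomIdeal.isUnmixed_L_iff K).1 h) hconn⟩
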